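/- Let $\Omega\subset\mathbb R^3$ be the open unit ball and let $q:\mathbb R^3\to\mathbb C$ be a bounded measurable function that vanishes on $\{|x|>r\}$ for some $r<1$ (for example $q=\Delta\gamma^{1/2}/\gamma^{1/2}$ in $\Omega$, extended by zero, where $\gamma\in C^2(\overline\Omega)$ is bounded below by a positive constant and equals $1$ near $\partial\Omega$). For $x\in\mathbb R^3$ and $\zeta,\eta\in\mathbb C^3$ write $x\cdot\zeta=\sum_i x_i\zeta_i$, $\zeta^2=\sum_i\zeta_i^2$, and for $\xi\in\mathbb R^3$ put $$\mathcal V=\{\zeta\in\mathbb C^3\setminus\{0\}:\zeta^2=0\},\qquad \mathcal V_\xi=\{\zeta\in\mathcal V:(\xi+\zeta)^2=0\}.$$ A CGO solution with frequency $\zeta\in\mathcal V$ is a distributional solution $\psi\in L^1_{\rm loc}(\mathbb R^3)$ of $(-\Delta+q)\psi=0$ in $\mathbb R^3$ such that $\mu-1\in L^2_\delta$ for some $\delta\in(-1,0)$, where $\mu(x)=e^{-ix\cdot\zeta}\psi(x)$ and $L^2_\delta=\{w:(1+|x|^2)^{\delta/2}w\in L^2(\mathbb R^3)\}$. When there is exactly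 one CGO solution $\psi(\cdot,\zeta)$ (up to equality almost everywhere), the scattering transform $$\mathbf t(\xi,\zeta)=\int_\Omega e^{-ix\cdot(\xi+\zeta)}\psi(x,\zeta)\,q(x)\,dx$$ is said to be well-defined at $\zeta$. For a function $f$ on $\partial\Omega$ such that the Dirichlet problem $(-\Delta+q)v=0$ in $\Omega$ (in the sense of distributions), $v=f$ on $\partial\Omega$, has exactly one solution $v\in C^1(\overline\Omega)$, let $\Lambda_qf=\partial v/\partial\nu|_{\partial\Omega}$; otherwise put $\Lambda_q f=0$. Define $$\mathbf t^{\exp}(\xi,\zeta)=\int_{\partial\Omega}e^{-ix\cdot(\xi+\zeta)}\big[(\Lambda_q-\Lambda_0)e^{i(\cdot)\cdot\zeta}\big](x)\,d\sigma(x).$$ Suppose that $q$ is real-valued and even, i.e. $q(-x)=q(x)$ for all $x\in\mathbb R^3$. Let $\xi\in\mathbb R^3$ and $\zeta\in\mathcal V_\xi$. Then $\overline\zeta\in\mathcal V_\xi$, and the following hold. 1. If $\mathbf t(\xi,\zeta)$ is well-defined (there is exactly one CGO solution with frequency $\zeta$), then so is $\mathbf t(\xi,\overline\zeta)$, and $\overline{\mathbf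 t(\xi,\zeta)}=\mathbf t(\xi,\overline\zeta)$. 2. If the Dirichlet problem above is uniquely solvable for the boundary value $e^{ix\cdot\zeta}$, then it is so for the boundary value $e^{ix\cdot\overline\zeta}$; and $\overline{\mathbf t^{\exp}(\xi,\zeta)}=\mathbf t^{\exp}(\xi,\overline\zeta)$. -/

import Mathlib

open MeasureTheory Metric Set
open scoped ContDiff ComplexConjugate Laplacian

noncomputable section

namespace ScatteringTransform

/-- Three-dimensional Euclidean space `ℝ³`. The domain `Ω` is the open unit ball `ball (0 : E3) 1`. -/
abbrev E3 : Type := EuclideanSpace ℝ (Fin 3)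

/-- The bilinear product `x · ζ = ∑ᵢ xᵢ ζᵢ` of `x ∈ ℝ³` and `ζ ∈ ℂ³`. -/
def cdot (x : E3) (ζ : Fin 3 → ℂ) : ℂ := ∑ i, (x i : ℂ) * ζ i

/-- The vector `ξ + ζ ∈ ℂ³`, for `ξ ∈ ℝ³` and `ζ ∈ ℂ³`. -/
def cadd (ξ : E3) (ζ : Fin 3 → ℂ) : Fin 3 → ℂ := fun i => (ξ i : ℂ) + ζ i

/-- The componentwise complex conjugate of `ζ ∈ ℂ³`. -/
def cconj (ζ : Fin 3 → ℂ) : Fin 3 → ℂ := fun i => conj (ζ i)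

/-- `V = {ζ ∈ ℂ³ \ {0} : ζ · ζ = 0}` (bilinear square). -/
def V : Set (Fin 3 → ℂ) := {ζ | ζ ≠ 0 ∧ ∑ i, ζ i ^ 2 = 0}

/-- `V_ξ = {ζ ∈ V : (ξ + ζ)² = 0}` (bilinear square). -/
def Vxi (ξ : E3) : Set (Fin 3 → ℂ) := {ζ | ζ ∈ V ∧ ∑ i, cadd ξ ζ i ^ 2 = 0}

/-- The exponential `x ↦ exp (i x · ζ)`. -/
def planeWave (ζ : Fin 3 → ℂ) (x : E3) : ℂ := Complex.exp (Complex.I * cdot x ζ)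

/-- Bounded measurable potentials that vanish near `∂Ω` and are extended by zero outside `Ω`. -/
structure IsPotential (q : E3 → ℂ) : Prop where
  measurable : Measurable q
  bounded : ∃ M : ℝ, ∀ x, ‖q x‖ ≤ M
  vanishes : ∃ r < (1 : ℝ), ∀ x, r < ‖x‖ → q x = 0

/-- `(-Δ + q) ψ = 0` in the open set `U`, in the sense of distributions. -/
def IsWeakSolution (U : Set E3) (q ψ : E3 → ℂ) : Prop :=
  LocallyIntegrableOn ψ U ∧
    ∀ φ : E3 → ℂ, ContDiff ℝ ∞ φ → HasCompactSupport φ → tsupport φ ⊆ U →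
      ∫ x, ψ x * (-(Δ φ) x + q x * φ x) = 0

/-- `ψ` is a complex geometrical optics (CGO) solution with frequency `ζ`: it solves
`(-Δ + q) ψ = 0` in `ℝ³`, and `μ - 1`, where `μ(x) = exp (-i x · ζ) ψ(x)`, lies in the weighted
space `L²_δ = {w : (1 + |x|²)^(δ/2) w ∈ L²(ℝ³)}` for some `-1 < δ < 0`. -/
def IsCGO (q : E3 → ℂ) (ζ : Fin 3 → ℂ) (ψ : E3 → ℂ) : Prop :=
  IsWeakSolution univ q ψ ∧
    ∃ δ ∈ Ioo (-1 : ℝ) 0,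
      MemLp (fun x : E3 => (((1 + ‖x‖ ^ 2) ^ (δ / 2) : ℝ) : ℂ) *
        (Complex.exp (-Complex.I * cdot x ζ) * ψ x - 1)) 2 volume

/-- There is exactly one CGO solution with frequency `ζ` (up to equality almost everywhere). -/
def CGOWellPosed (q : E3 → ℂ) (ζ : Fin 3 → ℂ) : Prop :=
  (∃ ψ, IsCGO q ζ ψ) ∧ ∀ ψ₁ ψ₂, IsCGO q ζ ψ₁ → IsCGO q ζ ψ₂ → ψ₁ =ᵐ[volume] ψ₂

open Classical in
/-- The CGO solution `ψ(·, ζ)` (with the value `0` if it is not well-defined). -/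
def cgo (q : E3 → ℂ) (ζ : Fin 3 → ℂ) : E3 → ℂ :=
  if h : CGOWellPosed q ζ then h.1.choose else 0

/-- The scattering transform `t(ξ, ζ) = ∫_Ω exp (-i x · (ξ + ζ)) ψ(x, ζ) q(x) dx`. -/
def scatteringTransform (q : E3 → ℂ) (ξ : E3) (ζ : Fin 3 → ℂ) : ℂ :=
  ∫ x in ball (0 : E3) 1,
    Complex.exp (-Complex.I * cdot x (cadd ξ ζ)) * cgo q ζ x * q x

/-- `v`, of class `C¹` on the closed unit ball, solves `(-Δ + q) v = 0` in `Ω`, `v = f` on `∂Ω`.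
(For bounded `q` and smooth `f` every `H¹` solution is of this class, by elliptic regularity.) -/
structure IsDirichletSolution (q : E3 → ℂ) (f : sphere (0 : E3) 1 → ℂ) (v : E3 → ℂ) : Prop where
  contDiffOn : ContDiffOn ℝ 1 v (closedBall 0 1)
  weak : IsWeakSolution (ball 0 1) q v
  boundary : ∀ x : sphere (0 : E3) 1, v x = f x

/-- The Dirichlet problem with boundary value `f` has exactly one solution. -/
def DirichletWellPosed (q : E3 → ℂ) (f : sphere (0 : E3) 1 → ℂ) : Prop :=
  (∃ v, IsDirichletSolution q f v) ∧
    ∀ v₁ v₂, IsDirichletSolution q f v₁ → IsDirichletSolution q f v₂ →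
      EqOn v₁ v₂ (closedBall 0 1)

open Classical in
/-- The Dirichlet-to-Neumann map `Λ_q f = ∂v/∂ν` on `∂Ω`, where `v` solves `(-Δ + q) v = 0` in `Ω`
with `v = f` on `∂Ω`; the outer unit normal at `x` is `x` (with the value `0` if the
Dirichlet problem is not uniquely solvable). -/
def dnMap (q : E3 → ℂ) (f : sphere (0 : E3) 1 → ℂ) (x : sphere (0 : E3) 1) : ℂ :=
  if h : DirichletWellPosed q f then
    fderivWithin ℝ h.1.choose (closedBall 0 1) (x : E3) (x : E3)
  else 0

/-- The boundary value of `exp (i x · ζ)` on `∂Ω`. -/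
def planeWaveTrace (ζ : Fin 3 → ℂ) : sphere (0 : E3) 1 → ℂ := fun x => planeWave ζ x

/-- `t^exp(ξ, ζ) = ∫_{∂Ω} exp (-i x · (ξ + ζ)) (Λ_q - Λ_0) exp (i x · ζ) dσ(x)`, with `σ` the
surface measure of the unit sphere. -/
def scatteringTransformExp (q : E3 → ℂ) (ξ : E3) (ζ : Fin 3 → ℂ) : ℂ :=
  ∫ x : sphere (0 : E3) 1,
    Complex.exp (-Complex.I * cdot x (cadd ξ ζ)) *
      (dnMap q (planeWaveTrace ζ) x - dnMap 0 (planeWaveTrace ζ) x)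
    ∂(volume : Measure E3).toSphere

end ScatteringTransform

end

open MeasureTheory Metric Set
open scoped ContDiff ComplexConjugate Laplacian Topology Pointwise

noncomputable section

namespace ScatteringTransform

/-! The map `conjReflect` commutes with `Δ`, and with multiplication by `q` because `q` is real and
even. Conjugation and reflection each flip the sign of the exponent `i x · ζ`, up to replacing `ζ`
by its conjugate, so plane waves go to plane waves of conjugate frequency. Solutions of both
problems are thus carried from `ζ` to `cconj ζ`, and uniqueness is carried too since the map is an
involution. Conjugating the integrals and substituting `x ↦ -x` then gives both identities
(`cgo_cconj`, `dnMap_conjReflect`). -/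

/-- The antilinear involution `v ↦ conj (v (-·))` on functions on a space with a negation. -/
def conjReflect {X : Type*} [Neg X] (v : X → ℂ) : X → ℂ := fun x => conj (v (-x))

lemma conjReflect_conjReflect {X : Type*} [InvolutiveNeg X] (v : X → ℂ) :
    conjReflect (conjReflect v) = v := by
  funext x
  simp [conjReflect]

/-! ### Frequencies -/

lemma conj_cdot_neg (x : E3) (ζ : Fin 3 → ℂ) : conj (cdot (-x) ζ) = -cdot x (cconj ζ) := by
  simp [cdot, cconj]

lemma cadd_cconj (ξ : E3) (ζ : Fin 3 → ℂ) : cadd ξ (cconj ζ) = cconj (cadd ξ ζ) := by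
  funext i
  simp [cadd, cconj]

lemma cconj_cconj (ζ : Fin 3 → ℂ) : cconj (cconj ζ) = ζ := by
  funext i
  simp [cconj]

lemma sum_sq_cconj (ζ : Fin 3 → ℂ) : ∑ i, cconj ζ i ^ 2 = conj (∑ i, ζ i ^ 2) := by
  simp [cconj]

lemma cconj_mem_Vxi {ξ : E3} {ζ : Fin 3 → ℂ} (h : ζ ∈ Vxi ξ) : cconj ζ ∈ Vxi ξ := by
  obtain ⟨⟨h0, h1⟩, h2⟩ := h
  refine ⟨⟨fun h => h0 ?_, ?_⟩, ?_⟩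
  · rw [← cconj_cconj ζ, h]
    funext i
    simp [cconj]
  · rw [sum_sq_cconj, h1, map_zero]
  · rw [cadd_cconj, sum_sq_cconj, h2, map_zero]

lemma conj_exp_neg_I_cdot_neg (x : E3) (ζ : Fin 3 → ℂ) :
    conj (Complex.exp (-Complex.I * cdot (-x) ζ)) =
      Complex.exp (-Complex.I * cdot x (cconj ζ)) := by
  rw [← Complex.exp_conj]
  simp [conj_cdot_neg]

lemma conjReflect_planeWaveTrace (ζ : Fin 3 → ℂ) :
    conjReflect (planeWaveTrace ζ) = planeWaveTrace (cconj ζ) := by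
  funext x
  simp only [conjReflect, planeWaveTrace, planeWave, ← Complex.exp_conj]
  simp [conj_cdot_neg]

/-! ### Weak solutions -/

lemma laplacian_conjReflect {φ : E3 → ℂ} (h : ContDiff ℝ 2 φ) (x : E3) :
    (Δ (conjReflect φ)) x = conj ((Δ φ) (-x)) := by
  have h1 : conjReflect φ = Complex.conjCLE ∘ (fun x => φ (-x)) := rfl
  rw [h1, InnerProductSpace.laplacian_CLE_comp_left]
  have h2 : (Δ (fun x => φ (-x))) x = (Δ φ) (-x) := by
    simp only [InnerProductSpace.laplacian_eq_iteratedFDeriv_stdOrthonormalBasis]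
    refine Finset.sum_congr rfl fun i _ => ?_
    have h3 : (fun x => φ (-x)) = φ ∘ (-ContinuousLinearMap.id ℝ E3) := rfl
    rw [h3, ContinuousLinearMap.iteratedFDeriv_comp_right _ h _ le_rfl]
    simp [iteratedFDeriv_two_apply]
  simp [h2]

lemma hasCompactSupport_conjReflect {φ : E3 → ℂ} (h : HasCompactSupport φ) :
    HasCompactSupport (conjReflect φ) :=
  (h.comp_homeomorph (Homeomorph.neg E3)).comp_left (g := conj) (map_zero _)

lemma tsupport_conjReflect (φ : E3 → ℂ) : tsupport (conjReflect φ) = -tsupport φ := by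
  have h : Function.support (conjReflect φ) = -Function.support φ := by
    ext x
    simp [conjReflect]
  rw [tsupport, h, tsupport, neg_closure]

lemma contDiff_conjReflect {φ : E3 → ℂ} {n : WithTop ℕ∞} (h : ContDiff ℝ n φ) :
    ContDiff ℝ n (conjReflect φ) :=
  Complex.conjCLE.contDiff.comp (h.comp contDiff_neg)

lemma locallyIntegrableOn_conjReflect {U : Set E3} (hU : -U = U) {ψ : E3 → ℂ}
    (h : LocallyIntegrableOn ψ U) : LocallyIntegrableOn (conjReflect ψ) U := by
  intro x hx
  obtain ⟨s, hs, hi⟩ := h (-x) (by rw [← hU]; simpa using hx)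
  refine ⟨Neg.neg ⁻¹' s, ?_, ?_⟩
  · have ht : Filter.Tendsto (fun y : E3 => -y) (𝓝[U] x) (𝓝[U] (-x)) := by
      refine tendsto_nhdsWithin_of_tendsto_nhds_of_eventually_within _
        (continuous_neg.continuousAt.tendsto.mono_left nhdsWithin_le_nhds) ?_
      filter_upwards [self_mem_nhdsWithin] with y hy
      rw [← hU]
      simpa using hy
    exact ht hs
  · have h2 : IntegrableOn (ψ ∘ Neg.neg) (Neg.neg ⁻¹' s) volume :=
      ((Measure.measurePreserving_neg (volume : Measure E3)).integrableOn_comp_preimage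
        (MeasurableEquiv.neg E3).measurableEmbedding).2 hi
    exact Complex.conjLIE.integrable_comp_iff.2 h2

/-- Conjugate reflection preserves the equation when `q` is real-valued and even. -/
lemma IsWeakSolution.conjReflect {U : Set E3} (hU : -U = U) {q ψ : E3 → ℂ}
    (hq : conjReflect q = q) (h : IsWeakSolution U q ψ) :
    IsWeakSolution U q (conjReflect ψ) := by
  refine ⟨locallyIntegrableOn_conjReflect hU h.1, fun φ h1 h2 h3 => ?_⟩
  -- The pairing of `conjReflect ψ` with `φ` is the conjugate of that of `ψ` with `conjReflect φ`.
  have key := h.2 (ScatteringTransform.conjReflect φ) (contDiff_conjReflect h1)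
    (hasCompactSupport_conjReflect h2)
    (by rw [tsupport_conjReflect, ← hU]; exact Set.neg_subset_neg.2 h3)
  rw [← integral_neg_eq_self, ← map_zero conj, ← key, ← integral_conj]
  refine integral_congr_ae (Filter.Eventually.of_forall fun x => ?_)
  have hqx : conj (q x) = q (-x) := by
    conv_rhs => rw [← hq]
    simp [ScatteringTransform.conjReflect]
  simp only [laplacian_conjReflect (contDiff_infty.1 h1 2), map_mul, map_add, map_neg, hqx]
  simp [ScatteringTransform.conjReflect]

/-! ### CGO solutions -/

/-- The weight is real and even and the constant `1` is fixed, so the same `δ` works. -/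
lemma IsCGO.conjReflect {q ψ : E3 → ℂ} {ζ : Fin 3 → ℂ} (hq : conjReflect q = q)
    (h : IsCGO q ζ ψ) : IsCGO q (cconj ζ) (conjReflect ψ) := by
  obtain ⟨h1, δ, hδ, h2⟩ := h
  refine ⟨h1.conjReflect (by simp) hq, δ, hδ, ?_⟩
  convert (h2.comp_measurePreserving (Measure.measurePreserving_neg (volume : Measure E3))).star
    using 1
  funext x
  rw [← conj_exp_neg_I_cdot_neg]
  simp [ScatteringTransform.conjReflect]

lemma conjReflect_ae_congr {ψ₁ ψ₂ : E3 → ℂ} (h : ψ₁ =ᵐ[volume] ψ₂) :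
    conjReflect ψ₁ =ᵐ[volume] conjReflect ψ₂ := by
  filter_upwards [(Measure.measurePreserving_neg (volume : Measure E3)).quasiMeasurePreserving.ae h]
    with x hx
  simp [conjReflect, hx]

lemma CGOWellPosed.cconj {q : E3 → ℂ} {ζ : Fin 3 → ℂ} (hq : conjReflect q = q)
    (h : CGOWellPosed q ζ) : CGOWellPosed q (cconj ζ) := by
  obtain ⟨⟨ψ, hψ⟩, h2⟩ := h
  refine ⟨⟨_, hψ.conjReflect hq⟩, fun ψ₁ ψ₂ h₁ h₂ => ?_⟩
  have h₁' := h₁.conjReflect hq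
  have h₂' := h₂.conjReflect hq
  rw [cconj_cconj] at h₁' h₂'
  simpa only [conjReflect_conjReflect] using conjReflect_ae_congr (h2 _ _ h₁' h₂')

lemma cgo_isCGO {q : E3 → ℂ} {ζ : Fin 3 → ℂ} (h : CGOWellPosed q ζ) : IsCGO q ζ (cgo q ζ) := by
  rw [cgo, dif_pos h]
  exact h.1.choose_spec

/-- Both sides are CGO solutions at `cconj ζ`. As `cgo` is a choice, uniqueness gives only a.e.
equality, which suffices under the integral. -/
lemma cgo_cconj {q : E3 → ℂ} {ζ : Fin 3 → ℂ} (hq : conjReflect q = q) (h : CGOWellPosed q ζ) :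
    cgo q (cconj ζ) =ᵐ[volume] conjReflect (cgo q ζ) :=
  (h.cconj hq).2 _ _ (cgo_isCGO (h.cconj hq)) ((cgo_isCGO h).conjReflect hq)

lemma conj_scatteringTransform {q : E3 → ℂ} {ζ : Fin 3 → ℂ} (ξ : E3) (hq : conjReflect q = q)
    (h : CGOWellPosed q ζ) :
    conj (scatteringTransform q ξ ζ) = scatteringTransform q ξ (cconj ζ) := by
  have hball : Neg.neg ⁻¹' ball (0 : E3) 1 = ball 0 1 := by
    ext x
    simp
  rw [scatteringTransform, scatteringTransform, ← integral_conj,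
    ← (Measure.measurePreserving_neg (volume : Measure E3)).setIntegral_preimage_emb
      (MeasurableEquiv.neg E3).measurableEmbedding, hball]
  refine integral_congr_ae ?_
  filter_upwards [ae_restrict_of_ae (cgo_cconj hq h)] with x hx
  have hqx : conj (q (-x)) = q x := congrFun hq x
  rw [hx, cadd_cconj, ← conj_exp_neg_I_cdot_neg]
  simp [conjReflect, hqx]

/-! ### The Dirichlet problem -/

lemma IsDirichletSolution.conjReflect {q v : E3 → ℂ} {f : sphere (0 : E3) 1 → ℂ}
    (hq : conjReflect q = q) (h : IsDirichletSolution q f v) :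
    IsDirichletSolution q (conjReflect f) (conjReflect v) where
  contDiffOn := Complex.conjCLE.contDiff.comp_contDiffOn
    (h.contDiffOn.comp contDiff_neg.contDiffOn fun x hx => by simpa using hx)
  weak := h.weak.conjReflect (by simp) hq
  boundary x := by
    have := h.boundary (-x)
    simp only [ScatteringTransform.conjReflect, ← this]
    simp

lemma DirichletWellPosed.conjReflect {q : E3 → ℂ} {f : sphere (0 : E3) 1 → ℂ}
    (hq : conjReflect q = q) (h : DirichletWellPosed q f) :
    DirichletWellPosed q (conjReflect f) := by
  obtain ⟨⟨v, hv⟩, h2⟩ := h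
  refine ⟨⟨_, hv.conjReflect hq⟩, fun v₁ v₂ h₁ h₂ x hx => ?_⟩
  have h₁' := h₁.conjReflect hq
  have h₂' := h₂.conjReflect hq
  rw [conjReflect_conjReflect] at h₁' h₂'
  have := h2 _ _ h₁' h₂' (x := -x) (by simpa using hx)
  simpa only [ScatteringTransform.conjReflect, neg_neg, (starRingEnd ℂ).injective.eq_iff]
    using this

/-- For `y = x` on the sphere, `-y` is the outer normal at `-x`, so normal derivatives match. -/
lemma fderivWithin_conjReflect {v : E3 → ℂ} (hv : ContDiffOn ℝ 1 v (closedBall 0 1))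
    {x : E3} (hx : x ∈ closedBall (0 : E3) 1) (y : E3) :
    fderivWithin ℝ (conjReflect v) (closedBall 0 1) x y =
      conj (fderivWithin ℝ v (closedBall 0 1) (-x) (-y)) := by
  have hx' : -x ∈ closedBall (0 : E3) 1 := by simpa using hx
  have hu : UniqueDiffOn ℝ (closedBall (0 : E3) 1) :=
    uniqueDiffOn_convex (convex_closedBall 0 1)
      ⟨0, by rw [interior_closedBall _ one_ne_zero]; simp⟩
  have h1 := ((hv.differentiableOn one_ne_zero) (-x) hx').hasFDerivWithinAt
  have h2 : HasFDerivWithinAt (fun z : E3 => -z) (-ContinuousLinearMap.id ℝ E3)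
      (closedBall 0 1) x := (hasFDerivWithinAt_id x _).neg
  have h3 := Complex.conjCLE.toContinuousLinearMap.hasFDerivAt.comp_hasFDerivWithinAt x
    (h1.comp x h2 fun z hz => by simpa using hz)
  have h4 : HasFDerivWithinAt (conjReflect v) _ (closedBall 0 1) x := h3
  rw [h4.fderivWithin (hu x hx)]
  simp

lemma dnMap_conjReflect {q : E3 → ℂ} (hq : conjReflect q = q) (f : sphere (0 : E3) 1 → ℂ) :
    dnMap q (conjReflect f) = conjReflect (dnMap q f) := by
  funext x
  by_cases h : DirichletWellPosed q f
  · have h' := h.conjReflect hq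
    have hs : (x : E3) ∈ closedBall (0 : E3) 1 := sphere_subset_closedBall x.2
    -- Agreement on the closed ball is enough, since `fderivWithin` sees only values there.
    have heq : EqOn h'.1.choose (conjReflect h.1.choose) (closedBall 0 1) :=
      h'.2 _ _ h'.1.choose_spec (h.1.choose_spec.conjReflect hq)
    rw [dnMap, dif_pos h', fderivWithin_congr' heq hs,
      fderivWithin_conjReflect h.1.choose_spec.contDiffOn hs, conjReflect, dnMap, dif_pos h]
    simp
  -- Ill-posedness is also symmetric, so the default `0` occurs on both sides; hence the identity
  -- for `t^exp` needs no solvability assumption.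
  · have h' : ¬ DirichletWellPosed q (conjReflect f) := fun h' => h <| by
      simpa only [conjReflect_conjReflect] using h'.conjReflect hq
    rw [dnMap, dif_neg h', conjReflect, dnMap, dif_neg h, map_zero]

/-- Surface measure is a multiple of the volume of the cone over a set, and Lebesgue measure is
even. -/
lemma measurePreserving_neg_toSphere :
    MeasurePreserving (Neg.neg : sphere (0 : E3) 1 → sphere (0 : E3) 1)
      (volume : Measure E3).toSphere (volume : Measure E3).toSphere := by
  have hm : Measurable (Neg.neg : sphere (0 : E3) 1 → sphere (0 : E3) 1) :=
    continuous_neg.measurable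
  refine ⟨hm, Measure.ext fun s hs => ?_⟩
  rw [Measure.map_apply hm hs, Measure.toSphere_apply' _ (hm hs), Measure.toSphere_apply' _ hs]
  have h : ((↑) '' (Neg.neg ⁻¹' s) : Set E3) = -((↑) '' s) := by
    ext x
    constructor
    · rintro ⟨y, hy, rfl⟩
      exact ⟨-y, hy, by simp⟩
    · rintro ⟨y, hy, hyx⟩
      exact ⟨-y, by simpa using hy, by simp [hyx]⟩
  have h' : Ioo (0 : ℝ) 1 • (-((↑) '' s) : Set E3) = -(Ioo (0 : ℝ) 1 • ((↑) '' s)) := by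
    simp only [← Set.image_neg_eq_neg, ← Set.image2_smul, Set.image_image2, Set.image2_image_right,
      smul_neg]
  rw [h, h', Measure.measure_neg]

lemma conj_scatteringTransformExp {q : E3 → ℂ} (ξ : E3) (ζ : Fin 3 → ℂ)
    (hq : conjReflect q = q) :
    conj (scatteringTransformExp q ξ ζ) = scatteringTransformExp q ξ (cconj ζ) := by
  have h0 : conjReflect (0 : E3 → ℂ) = 0 := by
    funext x
    simp [conjReflect]
  rw [scatteringTransformExp, scatteringTransformExp, ← integral_conj,
    ← measurePreserving_neg_toSphere.integral_comp
      (Homeomorph.neg (sphere (0 : E3) 1)).measurableEmbedding]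
  refine integral_congr_ae (Filter.Eventually.of_forall fun x => ?_)
  simp only [← conjReflect_planeWaveTrace, dnMap_conjReflect hq, dnMap_conjReflect h0, cadd_cconj,
    ← conj_exp_neg_I_cdot_neg]
  simp [conjReflect]

end ScatteringTransform

end

theorem mainTheorem3 (q : ScatteringTransform.E3 → ℂ)
    (hq : ScatteringTransform.IsPotential q)
    (hreal : ∀ x, (starRingEnd ℂ) (q x) = q x)
    (heven : ∀ x, q (-x) = q x)
    (ξ : ScatteringTransform.E3) (ζ : Fin 3 → ℂ) (hζ : ζ ∈ ScatteringTransform.Vxi ξ) :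
    ScatteringTransform.cconj ζ ∈ ScatteringTransform.Vxi ξ ∧
    (ScatteringTransform.CGOWellPosed q ζ →
      ScatteringTransform.CGOWellPosed q (ScatteringTransform.cconj ζ) ∧
      (starRingEnd ℂ) (ScatteringTransform.scatteringTransform q ξ ζ) =
        ScatteringTransform.scatteringTransform q ξ (ScatteringTransform.cconj ζ)) ∧
    (ScatteringTransform.DirichletWellPosed q (ScatteringTransform.planeWaveTrace ζ) →
      ScatteringTransform.DirichletWellPosed q
        (ScatteringTransform.planeWaveTrace (ScatteringTransform.cconj ζ))) ∧
    (starRingEnd ℂ) (ScatteringTransform.scatteringTransformExp q ξ ζ) =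
      ScatteringTransform.scatteringTransformExp q ξ (ScatteringTransform.cconj ζ) := by
  have hq' : ScatteringTransform.conjReflect q = q := funext fun x => by
    rw [ScatteringTransform.conjReflect, hreal, heven]
  refine ⟨ScatteringTransform.cconj_mem_Vxi hζ,
    fun h => ⟨h.cconj hq', ScatteringTransform.conj_scatteringTransform ξ hq' h⟩, fun h => ?_,
    ScatteringTransform.conj_scatteringTransformExp ξ ζ hq'⟩
  rw [← ScatteringTransform.conjReflect_planeWaveTrace]
  exact h.conjReflect hq'
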